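/- Let $d \ge 1$. For $N \ge 1$ let $\mathcal{T}^N = \{1, \dots, N\}^d \subset \mathbb{Z}^d$, and for a permutation $\pi$ of $\mathcal{T}^N$ let $H^N(\pi) = \sum_{x \in \mathcal{T}^N} |x - \pi(x)|$, where $|\cdot|$ is the Euclidean norm on $\mathbb{R}^d$. For $\beta \ge 0$ let $P^N_\beta$ be the probability measure on the permutations of $\mathcal{T}^N$ given by $P^N_\beta(\pi) = e^{-\beta H^N(\pi)} / Z^N_\beta$, with $Z^N_\beta = \sum_{\pi} e^{-\beta H^N(\pi)}$, and let $$D^N_\beta = \frac{1}{N^d} \sum_{x \in \mathcal{T}^N} E\big[|x - \pi(x)|\big],$$ where $E$ is the expectation with respect to $P^N_\beta$. Let $\beta = \beta(N) \ge 0$ be any sequence of inverse temperatures. Then, as $N \to \infty$, $$D^N_{\beta} = \begin{cases} \Theta(1/\beta), & \text{if } 1/N \ll \beta \ll 1, \\ \Theta(N), & \text{if } \beta = O(1/N). \end{cases}$$ Here, for functions $f, g$ of $N$, $f \ll g$ means $|f|/|g| \to 0$ as $N \to \infty$; $f = O(g)$ means that there is a constant $c > 0$ (which may depend on $d$ and on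 the sequence $\beta(N)$) such that $|f| \le c\,|g|$ for all sufficiently large $N$; and $f = \Theta(g)$ means that both $f = O(g)$ and $g = O(f)$. -/

import Mathlib

open Filter
open scoped Asymptotics

noncomputable section

namespace RandomEuclideanBijection

/-- The lattice box `{1, …, N}^d ⊂ ℤ^d`. -/
def latticeBox (d N : ℕ) : Finset (Fin d → ℤ) :=
  Fintype.piFinset fun _ => Finset.Icc (1 : ℤ) (N : ℤ)

/-- A lattice point of `ℤ^d` as a point of Euclidean space `ℝ^d`. -/
def toEuclidean {d : ℕ} (x : Fin d → ℤ) : EuclideanSpace ℝ (Fin d) :=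
  WithLp.toLp 2 fun i => (x i : ℝ)

/-- The displacement `|x - π(x)|` (Euclidean norm) of the site `x` under the permutation `π`. -/
def displacement {d N : ℕ} (π : Equiv.Perm (latticeBox d N)) (x : latticeBox d N) : ℝ :=
  ‖toEuclidean (x : Fin d → ℤ) - toEuclidean (π x : Fin d → ℤ)‖

/-- The energy `H^N(π) = ∑_x |x - π(x)|`. -/
def energy {d N : ℕ} (π : Equiv.Perm (latticeBox d N)) : ℝ :=
  ∑ x : latticeBox d N, displacement π x

/-- The partition function `Z^N_β = ∑_π exp (-β H^N(π))`. -/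
def partitionFunction (d N : ℕ) (β : ℝ) : ℝ :=
  ∑ π : Equiv.Perm (latticeBox d N), Real.exp (-β * energy π)

/-- The Boltzmann probability `P^N_β(π) = exp (-β H^N(π)) / Z^N_β` of the permutation `π`. -/
def boltzmannProb (d N : ℕ) (β : ℝ) (π : Equiv.Perm (latticeBox d N)) : ℝ :=
  1 / partitionFunction d N β * Real.exp (-β * energy π)

/-- The expectation `E[f(π)]` when `π` is distributed according to `P^N_β`. -/
def boltzmannExpectation (d N : ℕ) (β : ℝ) (f : Equiv.Perm (latticeBox d N) → ℝ) : ℝ :=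
  ∑ π : Equiv.Perm (latticeBox d N), boltzmannProb d N β π * f π

/-- The mean displacement per site `D^N_β = N^{-d} ∑_x E[|x - π(x)|]`. -/
def meanDisplacement (d N : ℕ) (β : ℝ) : ℝ :=
  1 / (N : ℝ) ^ d *
    ∑ x : latticeBox d N, boltzmannExpectation d N β fun π => displacement π x

theorem partitionFunction_pos (d N : ℕ) (β : ℝ) : 0 < partitionFunction d N β :=
  Finset.sum_pos (fun _ _ => Real.exp_pos _) Finset.univ_nonempty

theorem boltzmannProb_pos (d N : ℕ) (β : ℝ) (π : Equiv.Perm (latticeBox d N)) :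
    0 < boltzmannProb d N β π :=
  mul_pos (one_div_pos.mpr (partitionFunction_pos d N β)) (Real.exp_pos _)

theorem sum_boltzmannProb (d N : ℕ) (β : ℝ) :
    ∑ π : Equiv.Perm (latticeBox d N), boltzmannProb d N β π = 1 := by
  unfold boltzmannProb
  rw [← Finset.mul_sum]
  exact one_div_mul_cancel (partitionFunction_pos d N β).ne'

/-- Equivalently, `D^N_β = N^{-d} E[H^N(π)]`. -/
theorem meanDisplacement_eq (d N : ℕ) (β : ℝ) :
    meanDisplacement d N β = 1 / (N : ℝ) ^ d * boltzmannExpectation d N β energy := by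
  unfold meanDisplacement boltzmannExpectation energy
  rw [Finset.sum_comm]
  simp only [Finset.mul_sum]

end RandomEuclideanBijection

end

namespace RandomEuclideanBijection

open scoped Nat

/-! Up to sign, the total mean energy is the derivative of the convex function log Z, so it is
controlled by finite increments: Jensen gives exp(-s E[H]) ≤ Z(β+s)/Z(β), a lower bound on E[H] for
s > 0 and an upper bound for s < 0. It therefore suffices to know Z up to a constant factor per
site.

For 1/N ≤ β ≤ 1 the value per site is of order β^(-d). Above, dropping injectivity bounds Z by a
product of row sums (`sum_perm_prod_le`, `row_sum_le`). Below, permutations preserving blocks of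
side ℓ ≈ 1/β number at least (ℓ^d/e)^(N^d) and cost O(1) in βH per site (`le_partitionFunction`).

The shift s = -β/2 then gives D ≤ C/β. A shift s = Kβ with K large makes the gain (1+K)^d beat all
constants, so D ≥ 1/(Kβ). If β = O(1/N), take ℓ = N and s = K/N; the upper bound is the diameter of
the box. -/

theorem card_latticeBox (d N : ℕ) : Fintype.card (latticeBox d N) = N ^ d := by
  rw [Fintype.card_coe, latticeBox, Fintype.card_piFinset]
  simp

theorem displacement_nonneg {d N : ℕ} (π : Equiv.Perm (latticeBox d N)) (x : latticeBox d N) :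
    0 ≤ displacement π x :=
  norm_nonneg _

theorem energy_nonneg {d N : ℕ} (π : Equiv.Perm (latticeBox d N)) : 0 ≤ energy π :=
  Finset.sum_nonneg fun x _ => displacement_nonneg π x

theorem mem_latticeBox {d N : ℕ} {x : Fin d → ℤ} :
    x ∈ latticeBox d N ↔ ∀ i, x i ∈ Finset.Icc (1 : ℤ) N :=
  Fintype.mem_piFinset

/-! ### Comparison of the Euclidean norm with coordinates -/

theorem abs_sub_le_norm_toEuclidean_sub {d : ℕ} (x y : Fin d → ℤ) (i : Fin d) :
    |(x i : ℝ) - y i| ≤ ‖toEuclidean x - toEuclidean y‖ := by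
  simpa [toEuclidean] using PiLp.norm_apply_le (toEuclidean x - toEuclidean y) i

theorem sum_abs_sub_le_mul_norm {d : ℕ} (x y : Fin d → ℤ) :
    ∑ i, |(x i : ℝ) - y i| ≤ d * ‖toEuclidean x - toEuclidean y‖ := by
  simpa using Finset.sum_le_card_nsmul Finset.univ (fun i => |(x i : ℝ) - y i|) _
    fun i _ => abs_sub_le_norm_toEuclidean_sub x y i

theorem norm_toEuclidean_sub_le {d : ℕ} (x y : Fin d → ℤ) {r : ℝ}
    (h : ∀ i, |(x i : ℝ) - y i| ≤ r) : ‖toEuclidean x - toEuclidean y‖ ≤ d * r := by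
  have h1 : ‖toEuclidean x - toEuclidean y‖ ≤ ∑ i, |(x i : ℝ) - y i| := by
    rw [EuclideanSpace.norm_eq]
    refine Real.sqrt_le_iff.mpr ⟨by positivity, ?_⟩
    simpa [toEuclidean] using
      Finset.sum_sq_le_sq_sum_of_nonneg (s := Finset.univ) (f := fun i => |(x i : ℝ) - y i|)
        fun i _ => abs_nonneg _
  refine h1.trans ?_
  simpa using Finset.sum_le_card_nsmul Finset.univ (fun i => |(x i : ℝ) - y i|) r fun i _ => h i

/-! ### Upper bound on the partition function -/

theorem sum_pow_le_of_injOn {s : Finset ℤ} {g : ℤ → ℕ} (hg : Set.InjOn g s) {r : ℝ}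
    (h0 : 0 ≤ r) (h1 : r < 1) : ∑ y ∈ s, r ^ g y ≤ (1 - r)⁻¹ := by
  rw [← Finset.sum_image (f := fun n => r ^ n) hg, ← tsum_geometric_of_lt_one h0 h1]
  exact (summable_geometric_of_lt_one h0 h1).sum_le_tsum _ fun n _ => by positivity

theorem sum_exp_neg_mul_abs_sub_le (s : Finset ℤ) (x : ℤ) {t : ℝ} (ht : 0 < t) :
    ∑ y ∈ s, Real.exp (-t * |(x : ℝ) - y|) ≤ 2 * ((1 + t) / t) := by
  set r := Real.exp (-t) with hr
  have hr1 : r < 1 := by simpa [hr] using ht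
  -- This is 1 + t ≤ e^t, rearranged.
  have hinv : (1 - r)⁻¹ ≤ (1 + t) / t := by
    have h2 : r ≤ (1 + t)⁻¹ := by
      rw [hr, Real.exp_neg]
      gcongr
      linarith [Real.add_one_le_exp t]
    have h3 : t / (1 + t) ≤ 1 - r := by
      have : t / (1 + t) = 1 - (1 + t)⁻¹ := by field_simp; ring
      linarith
    rw [← inv_div t (1 + t)]
    gcongr
  have hterm : ∀ k : ℤ, ∀ n : ℕ, |k| = n → Real.exp (-t * |(k : ℝ)|) = r ^ n := by
    intro k n h
    have : |(k : ℝ)| = n := by exact_mod_cast h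
    rw [this, hr, ← Real.exp_nat_mul, mul_comm]
  have hle : ∑ y ∈ s with y ≤ x, Real.exp (-t * |(x : ℝ) - y|) ≤ (1 - r)⁻¹ := by
    refine le_trans (Finset.sum_le_sum fun y hy => ?_)
      (sum_pow_le_of_injOn (s := {y ∈ s | y ≤ x}) (g := fun y => (x - y).toNat) ?_
        (Real.exp_pos _).le hr1)
    · have := (Finset.mem_filter.mp hy).2
      exact le_of_eq (by simpa using hterm (x - y) (x - y).toNat (by grind))
    · intro a ha b hb hab
      simp only [Finset.coe_filter, Set.mem_ofPred_eq] at ha hb hab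
      omega
  have hge : ∑ y ∈ s with ¬ y ≤ x, Real.exp (-t * |(x : ℝ) - y|) ≤ (1 - r)⁻¹ := by
    refine le_trans (Finset.sum_le_sum fun y hy => ?_)
      (sum_pow_le_of_injOn (s := {y ∈ s | ¬ y ≤ x}) (g := fun y => (y - x).toNat) ?_
        (Real.exp_pos _).le hr1)
    · have := (Finset.mem_filter.mp hy).2
      exact le_of_eq (by simpa using hterm (x - y) (y - x).toNat (by grind))
    · intro a ha b hb hab
      simp only [Finset.coe_filter, Set.mem_ofPred_eq] at ha hb hab
      omega
  rw [← Finset.sum_filter_add_sum_filter_not s (· ≤ x)]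
  linarith

/-- Expanding the product of row sums gives one nonnegative term for each map α → α; the
permutations are some of these maps. -/
theorem sum_perm_prod_le {α : Type*} [Fintype α] [DecidableEq α] {f : α → α → ℝ}
    (hf : ∀ x y, 0 ≤ f x y) : ∑ π : Equiv.Perm α, ∏ x, f x (π x) ≤ ∏ x, ∑ y, f x y := by
  rw [Finset.prod_univ_sum, Fintype.piFinset_univ,
    ← Finset.sum_image (s := Finset.univ) (g := fun π : Equiv.Perm α => (π : α → α))
      (f := fun g => ∏ x, f x (g x)) DFunLike.coe_injective.injOn]
  exact Finset.sum_le_univ_sum_of_nonneg fun g => Finset.prod_nonneg fun x _ => hf _ _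

/-- The ℓ¹ distance is at most d times the Euclidean one, so at rate β/d the exponential is
dominated by a product over coordinates and the sum factors. -/
theorem row_sum_le {d N : ℕ} (hd : 1 ≤ d) {β : ℝ} (h0 : 0 < β) (h1 : β ≤ 1) (x : Fin d → ℤ) :
    ∑ y : latticeBox d N, Real.exp (-β * ‖toEuclidean x - toEuclidean (y : Fin d → ℤ)‖) ≤
      (2 * (d + 1)) ^ d / β ^ d := by
  have hd' : (0 : ℝ) < d := by exact_mod_cast hd
  calc
    _ ≤ ∑ y : latticeBox d N, ∏ i, Real.exp (-(β / d) * |(x i : ℝ) - y.1 i|) := by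
      refine Finset.sum_le_sum fun y _ => ?_
      rw [← Real.exp_sum, ← Finset.mul_sum]
      refine Real.exp_le_exp.mpr ?_
      have := mul_le_mul_of_nonneg_left (sum_abs_sub_le_mul_norm x y.1) (div_pos h0 hd').le
      have h2 : β / d * (d * ‖toEuclidean x - toEuclidean y.1‖) =
          β * ‖toEuclidean x - toEuclidean y.1‖ := by field_simp
      linarith
    _ = ∑ y ∈ latticeBox d N, ∏ i, Real.exp (-(β / d) * |(x i : ℝ) - y i|) :=
      Finset.sum_coe_sort (latticeBox d N)
        fun y => ∏ i, Real.exp (-(β / d) * |(x i : ℝ) - y i|)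
    _ = ∏ i, ∑ y ∈ Finset.Icc (1 : ℤ) N, Real.exp (-(β / d) * |(x i : ℝ) - y|) := by
      rw [Finset.prod_univ_sum]
      rfl
    _ ≤ ∏ _i : Fin d, 2 * ((d + 1) / β) := by
      refine Finset.prod_le_prod (fun i _ => by positivity) fun i _ => ?_
      refine (sum_exp_neg_mul_abs_sub_le _ _ (div_pos h0 hd')).trans ?_
      have : (1 + β / d) / (β / d) = (d + β) / β := by field_simp
      rw [this]
      gcongr
    _ = (2 * (d + 1)) ^ d / β ^ d := by
      rw [Finset.prod_const, Finset.card_univ, Fintype.card_fin, ← div_pow, mul_div_assoc]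

theorem partitionFunction_le {d N : ℕ} (hd : 1 ≤ d) {β : ℝ} (h0 : 0 < β) (h1 : β ≤ 1) :
    partitionFunction d N β ≤ ((2 * (d + 1)) ^ d / β ^ d) ^ N ^ d := by
  calc
    partitionFunction d N β = ∑ π : Equiv.Perm (latticeBox d N), ∏ x : latticeBox d N,
        Real.exp (-β * ‖toEuclidean (x : Fin d → ℤ) - toEuclidean (π x : Fin d → ℤ)‖) := by
      simp only [partitionFunction, energy, displacement, Finset.mul_sum, Real.exp_sum]
    _ ≤ ∏ x : latticeBox d N, ∑ y : latticeBox d N,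
        Real.exp (-β * ‖toEuclidean (x : Fin d → ℤ) - toEuclidean (y : Fin d → ℤ)‖) :=
      sum_perm_prod_le (f := fun x y : latticeBox d N => Real.exp (-β * ‖toEuclidean
        (x : Fin d → ℤ) - toEuclidean (y : Fin d → ℤ)‖)) fun _ _ => (Real.exp_pos _).le
    _ ≤ ∏ _x : latticeBox d N, (2 * ((d : ℝ) + 1)) ^ d / β ^ d :=
      Finset.prod_le_prod (fun _ _ => by positivity) fun x _ => row_sum_le hd h0 h1 x.1
    _ = _ := by rw [Finset.prod_const, Finset.card_univ, card_latticeBox]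

theorem partitionFunction_add_le (d N : ℕ) {β s : ℝ} (hβ : 0 ≤ β) :
    partitionFunction d N (β + s) ≤ partitionFunction d N s := by
  refine Finset.sum_le_sum fun π _ => Real.exp_le_exp.mpr ?_
  nlinarith [energy_nonneg π]

/-! ### Lower bound on the partition function -/

theorem pow_mul_exp_neg_le_factorial {m n : ℕ} (h : m ≤ n) :
    ((m : ℝ) * Real.exp (-1)) ^ n ≤ n ! := by
  have h1 := Real.pow_div_factorial_le_exp (n : ℝ) (by positivity) n
  rw [div_le_iff₀ (by positivity)] at h1
  rw [mul_pow, ← Real.exp_nat_mul, mul_neg_one, Real.exp_neg, ← div_eq_mul_inv,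
    div_le_iff₀ (Real.exp_pos _), mul_comm]
  exact (by gcongr : (m : ℝ) ^ n ≤ (n : ℝ) ^ n).trans h1

/-- The stabilizer of f is the product of the symmetric groups of its fibres. Each factorial is at
least (m/e) to the fibre size, and the sizes add up to the cardinality of α. -/
theorem pow_le_card_perm_preserving {α ι : Type*} [Fintype α] [DecidableEq α] [DecidableEq ι]
    (f : α → ι) {m : ℕ} (hm : ∀ x, m ≤ Fintype.card {a // f a = f x}) :
    ((m : ℝ) * Real.exp (-1)) ^ Fintype.card α ≤ Fintype.card {g : Equiv.Perm α // f ∘ g = f} := by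
  rw [DomMulAct.stabilizer_card' f]
  have h : Fintype.card α = ∑ i ∈ Finset.univ.image f, Fintype.card {a // f a = i} := by
    simp_rw [Fintype.card_subtype]
    exact Finset.card_eq_sum_card_image f Finset.univ
  rw [h, ← Finset.prod_pow_eq_pow_sum, Nat.cast_prod]
  refine Finset.prod_le_prod (fun _ _ => by positivity) fun i hi => ?_
  obtain ⟨x, -, rfl⟩ := Finset.mem_image.mp hi
  exact pow_mul_exp_neg_le_factorial (hm x)

/-- An interval of length `N` is cut into intervals of length between `ℓ` and `2ℓ`. -/
theorem exists_interval_partition {N ℓ : ℕ} (h1 : 1 ≤ ℓ) (hN : ℓ ≤ N) :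
    ∃ f : ℤ → ℤ,
      (∀ x ∈ Finset.Icc (1 : ℤ) N, ∀ y ∈ Finset.Icc (1 : ℤ) N, f x = f y → |x - y| ≤ 2 * ℓ) ∧
      ∀ x ∈ Finset.Icc (1 : ℤ) N, ∃ a : ℤ, Finset.Icc (a + 1) (a + ℓ) ⊆ Finset.Icc (1 : ℤ) N ∧
        ∀ z ∈ Finset.Icc (a + 1) (a + ℓ), f z = f x := by
  have hℓ : (0 : ℤ) < ℓ := by exact_mod_cast h1
  set q : ℤ := (N : ℤ) / ℓ with hq
  have hq1 : 1 ≤ q := (Int.le_ediv_iff_mul_le hℓ).mpr (by omega)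
  have hqN : q * ℓ ≤ N := Int.ediv_mul_le _ hℓ.ne'
  have hNq : (N : ℤ) < (q + 1) * ℓ := Int.lt_ediv_add_one_mul_self _ hℓ
  -- The minimum merges the incomplete last interval into its predecessor, so that no interval is
  -- shorter than ℓ.
  set f : ℤ → ℤ := fun x => min ((x - 1) / ℓ) (q - 1) with hf
  have key : ∀ x ∈ Finset.Icc (1 : ℤ) N, 0 ≤ f x ∧ f x ≤ q - 1 ∧ f x * ℓ + 1 ≤ x ∧
      x ≤ f x * ℓ + 2 * ℓ := by
    intro x hx
    rw [Finset.mem_Icc] at hx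
    have a1 : (x - 1) / ℓ * ℓ ≤ x - 1 := Int.ediv_mul_le _ hℓ.ne'
    have a2 : x - 1 < ((x - 1) / ℓ + 1) * ℓ := Int.lt_ediv_add_one_mul_self _ hℓ
    have a3 : 0 ≤ (x - 1) / ℓ := Int.ediv_nonneg (by omega) hℓ.le
    simp only [hf]
    rcases le_total ((x - 1) / ℓ) (q - 1) with h | h
    · rw [min_eq_left h]
      exact ⟨a3, h, by linarith, by linarith⟩
    · rw [min_eq_right h]
      exact ⟨by omega, le_rfl, by nlinarith, by linarith⟩
  refine ⟨f, fun x hx y hy hxy => ?_, fun x hx => ⟨f x * ℓ, fun z hz => ?_, fun z hz => ?_⟩⟩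
  · have kx := key x hx
    have ky := key y hy
    rw [← hxy] at ky
    rw [abs_le]
    constructor <;> linarith
  · obtain ⟨k1, k2, -, -⟩ := key x hx
    rw [Finset.mem_Icc] at hz ⊢
    constructor <;> nlinarith
  · obtain ⟨k1, k2, -, -⟩ := key x hx
    rw [Finset.mem_Icc] at hz
    have : (z - 1) / ℓ = f x := by
      rw [Int.ediv_eq_iff_of_pos hℓ]
      constructor <;> linarith
    change min ((z - 1) / ℓ) (q - 1) = f x
    rw [this, min_eq_left k2]

/-- Only permutations preserving the cells of a product partition are kept: each cell contains a
cube of side ℓ, and no site moves by more than 2dℓ. -/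
theorem le_partitionFunction {d N ℓ : ℕ} (h1 : 1 ≤ ℓ) (hN : ℓ ≤ N) {β : ℝ} (hβ : 0 ≤ β) :
    ((ℓ : ℝ) ^ d * Real.exp (-1 - 2 * d * (β * ℓ))) ^ N ^ d ≤ partitionFunction d N β := by
  obtain ⟨f, hf1, hf2⟩ := exists_interval_partition h1 hN
  set F : latticeBox d N → Fin d → ℤ := fun x i => f (x.1 i) with hF
  have hcard : ∀ x, ℓ ^ d ≤ Fintype.card {a // F a = F x} := by
    intro x
    choose a ha1 ha2 using fun i => hf2 (x.1 i) (mem_latticeBox.mp x.2 i)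
    set S : Finset (Fin d → ℤ) := Fintype.piFinset fun i => Finset.Icc (a i + 1) (a i + ℓ)
    have hS : ∀ z : S, ∀ i, z.1 i ∈ Finset.Icc (a i + 1) (a i + ℓ) :=
      fun z => Fintype.mem_piFinset.mp z.2
    have hSc : Fintype.card S = ℓ ^ d := by
      rw [Fintype.card_coe, Fintype.card_piFinset]
      simp
    rw [← hSc]
    refine Fintype.card_le_of_injective
      (fun z : S => ⟨⟨z.1, mem_latticeBox.mpr fun i => ha1 i (hS z i)⟩,
        funext fun i => ha2 i _ (hS z i)⟩) fun z w h => ?_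
    exact Subtype.ext (congrArg (fun u => u.1.1) h)
  have hen : ∀ π : Equiv.Perm (latticeBox d N), F ∘ π = F →
      energy π ≤ (N ^ d : ℕ) * (2 * d * ℓ : ℝ) := by
    intro π hπ
    have : ∀ x, displacement π x ≤ 2 * d * ℓ := by
      intro x
      refine (norm_toEuclidean_sub_le _ _ (r := 2 * ℓ) fun i => ?_).trans (le_of_eq (by ring))
      have := hf1 _ (mem_latticeBox.mp x.2 i) _ (mem_latticeBox.mp (π x).2 i)
        (congrFun (congrFun hπ x) i).symm
      exact_mod_cast this
    simpa [energy, ← card_latticeBox] using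
      Finset.sum_le_card_nsmul Finset.univ (displacement π) _ fun x _ => this x
  calc
    _ = (((ℓ ^ d : ℕ) : ℝ) * Real.exp (-1)) ^ Fintype.card (latticeBox d N) *
        Real.exp (-β * ((N ^ d : ℕ) * (2 * d * ℓ))) := by
      have : -β * (((N ^ d : ℕ) : ℝ) * (2 * d * ℓ)) = (N ^ d : ℕ) * (-(2 * d * (β * ℓ))) := by ring
      rw [card_latticeBox, this, Real.exp_nat_mul, ← mul_pow,
        mul_assoc _ (Real.exp _) (Real.exp _), ← Real.exp_add, Nat.cast_pow, ← sub_eq_add_neg]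
    _ ≤ Fintype.card {g : Equiv.Perm (latticeBox d N) // F ∘ g = F} *
        Real.exp (-β * ((N ^ d : ℕ) * (2 * d * ℓ))) := by
      gcongr
      exact pow_le_card_perm_preserving F hcard
    _ ≤ ∑ π ∈ {π : Equiv.Perm (latticeBox d N) | F ∘ π = F}, Real.exp (-β * energy π) := by
      rw [Fintype.card_subtype, ← nsmul_eq_mul]
      refine Finset.card_nsmul_le_sum _ _ _ fun π hπ => Real.exp_le_exp.mpr ?_
      nlinarith [hen π (Finset.mem_filter.mp hπ).2]
    _ ≤ partitionFunction d N β :=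
      Finset.sum_le_univ_sum_of_nonneg fun π => (Real.exp_pos _).le

/-! ### Mean displacement -/

theorem meanDisplacement_nonneg (d N : ℕ) (β : ℝ) : 0 ≤ meanDisplacement d N β :=
  mul_nonneg (by positivity) <| Finset.sum_nonneg fun x _ => Finset.sum_nonneg fun π _ =>
    mul_nonneg (boltzmannProb_pos d N β π).le (displacement_nonneg π x)

theorem meanDisplacement_le {d N : ℕ} (β : ℝ) : meanDisplacement d N β ≤ d * N := by
  have hdisp : ∀ π : Equiv.Perm (latticeBox d N), ∀ x, displacement π x ≤ d * N := by
    refine fun π x => norm_toEuclidean_sub_le _ _ fun i => ?_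
    have h1 := Finset.mem_Icc.mp (mem_latticeBox.mp x.2 i)
    have h2 := Finset.mem_Icc.mp (mem_latticeBox.mp (π x).2 i)
    have : |x.1 i - (π x).1 i| ≤ (N : ℤ) := by grind
    exact_mod_cast this
  have hexp : ∀ x : latticeBox d N,
      (boltzmannExpectation d N β fun π => displacement π x) ≤ d * N := by
    intro x
    rw [← one_mul ((d : ℝ) * N), ← sum_boltzmannProb d N β, Finset.sum_mul]
    exact Finset.sum_le_sum fun π _ =>
      mul_le_mul_of_nonneg_left (hdisp π x) (boltzmannProb_pos d N β π).le
  have hsum := Finset.sum_le_card_nsmul Finset.univ _ _ fun x _ => hexp x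
  rw [Finset.card_univ, card_latticeBox, nsmul_eq_mul, Nat.cast_pow] at hsum
  rw [meanDisplacement, one_div_mul_eq_div]
  exact div_le_of_le_mul₀ (by positivity) (by positivity) (by linarith)

/-- Jensen's inequality for the Boltzmann measure. -/
theorem exp_neg_mul_boltzmannExpectation_energy_le (d N : ℕ) (β s : ℝ) :
    Real.exp (-s * boltzmannExpectation d N β energy) * partitionFunction d N β ≤
      partitionFunction d N (β + s) := by
  have h := convexOn_exp.map_sum_le (t := Finset.univ) (w := boltzmannProb d N β)
    (p := fun π => -s * energy π) (fun π _ => (boltzmannProb_pos d N β π).le)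
    (sum_boltzmannProb d N β) fun _ _ => Set.mem_univ _
  have h1 : ∑ π, boltzmannProb d N β π • (-s * energy π) =
      -s * boltzmannExpectation d N β energy := by
    rw [boltzmannExpectation, Finset.mul_sum]
    exact Finset.sum_congr rfl fun π _ => by rw [smul_eq_mul]; ring
  have h2 : ∑ π, boltzmannProb d N β π • Real.exp (-s * energy π) =
      partitionFunction d N (β + s) / partitionFunction d N β := by
    rw [partitionFunction, Finset.sum_div]
    refine Finset.sum_congr rfl fun π _ => ?_
    rw [neg_add, add_mul, Real.exp_add, boltzmannProb, smul_eq_mul]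
    ring
  rw [h1, h2, le_div_iff₀ (partitionFunction_pos d N β)] at h
  exact h

/-- The logarithm of Jensen's inequality, divided by the number of sites. The sign of s decides
whether the displacement is bounded below or above. -/
theorem log_div_le_mul_meanDisplacement {d N : ℕ} (hN : 1 ≤ N) {β s A B : ℝ} (hA : 0 < A)
    (hB : 0 < B) (hZA : A ^ N ^ d ≤ partitionFunction d N β)
    (hZB : partitionFunction d N (β + s) ≤ B ^ N ^ d) :
    Real.log (A / B) ≤ s * meanDisplacement d N β := by
  have hn : (0 : ℝ) < (N ^ d : ℕ) := by positivity
  have h := (mul_le_mul_of_nonneg_left hZA (Real.exp_pos _).le).trans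
    ((exp_neg_mul_boltzmannExpectation_energy_le d N β s).trans hZB)
  have h2 := Real.log_le_log (by positivity) h
  rw [Real.log_mul (by positivity) (by positivity), Real.log_exp, Real.log_pow, Real.log_pow] at h2
  have h3 : boltzmannExpectation d N β energy = (N ^ d : ℕ) * meanDisplacement d N β := by
    rw [meanDisplacement_eq, Nat.cast_pow]
    field_simp
  rw [h3] at h2
  rw [Real.log_div hA.ne' hB.ne']
  refine le_of_mul_le_mul_left ?_ hn
  linarith

theorem le_partitionFunction_of_one_le_mul {d N : ℕ} {β : ℝ} (h0 : 0 < β) (h1 : β ≤ 1)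
    (hN : 1 ≤ β * N) :
    (Real.exp (-1 - 2 * d) / 2 ^ d / β ^ d) ^ N ^ d ≤ partitionFunction d N β := by
  -- The block side is ⌊1/β⌋: it lies between 1/(2β) and 1/β, and 1 ≤ βN makes it fit in the box.
  have hinv : 1 ≤ 1 / β := by rwa [one_le_div h0]
  have hfloor : 1 ≤ ⌊1 / β⌋₊ := (Nat.one_le_floor_iff _).mpr hinv
  have hle : (⌊1 / β⌋₊ : ℝ) ≤ 1 / β := Nat.floor_le (by positivity)
  have hhalf : 1 / (2 * β) ≤ (⌊1 / β⌋₊ : ℝ) := by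
    have h2 := Nat.lt_floor_add_one (1 / β)
    have h3 : (1 : ℝ) ≤ ⌊1 / β⌋₊ := by exact_mod_cast hfloor
    have h4 : 1 / (2 * β) = 1 / β / 2 := by field_simp
    linarith
  have hβℓ : β * ⌊1 / β⌋₊ ≤ 1 := by
    rw [mul_comm]
    exact (le_div_iff₀ h0).mp hle
  have hℓN : ⌊1 / β⌋₊ ≤ N := Nat.floor_le_of_le <| by rwa [div_le_iff₀ h0, mul_comm]
  refine le_trans ?_ (le_partitionFunction (d := d) hfloor hℓN h0.le)
  refine pow_le_pow_left₀ (by positivity) ?_ _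
  calc
    _ = (1 / (2 * β)) ^ d * Real.exp (-1 - 2 * d) := by
      rw [div_pow, mul_pow, one_pow]
      field_simp
    _ ≤ _ := by
      refine mul_le_mul (by gcongr) (Real.exp_le_exp.mpr ?_) (by positivity) (by positivity)
      nlinarith [(Nat.cast_nonneg d : (0 : ℝ) ≤ d)]

/-! ### Displacement bounds in the two regimes -/

theorem exists_meanDisplacement_le_div {d : ℕ} (hd : 1 ≤ d) :
    ∃ C : ℝ, ∀ (N : ℕ) (β : ℝ), 0 < β → β ≤ 1 → 1 ≤ β * N →
      meanDisplacement d N β ≤ C * (1 / β) := by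
  set U : ℝ := (2 * (d + 1)) ^ d with hU
  set L : ℝ := Real.exp (-1 - 2 * d) / 2 ^ d with hL
  -- With s = -β/2 the powers of β cancel in A/B, leaving a constant that depends on d alone.
  refine ⟨-2 * Real.log (L / (U * 2 ^ d)), fun N β h0 h1 hN => ?_⟩
  have hN1 : 1 ≤ N := Nat.one_le_iff_ne_zero.mpr fun h => by simp [h] at hN; linarith
  have h := log_div_le_mul_meanDisplacement (s := -(β / 2)) hN1
    (A := L / β ^ d) (B := U / (β / 2) ^ d) (by positivity) (by positivity)
    (le_partitionFunction_of_one_le_mul h0 h1 hN)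
    (by
      have : β + -(β / 2) = β / 2 := by ring
      rw [this]
      exact partitionFunction_le hd (by positivity) (by linarith))
  have hAB : L / β ^ d / (U / (β / 2) ^ d) = L / (U * 2 ^ d) := by
    rw [div_pow]
    field_simp
  rw [hAB] at h
  rw [mul_one_div, le_div_iff₀ h0]
  linarith

theorem exists_inv_le_meanDisplacement {d : ℕ} (hd : 1 ≤ d) :
    ∃ K : ℝ, 0 < K ∧ ∀ (N : ℕ) (β : ℝ), 0 < β → (1 + K) * β ≤ 1 → 1 ≤ β * N →
      1 / β ≤ K * meanDisplacement d N β := by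
  set U : ℝ := (2 * (d + 1)) ^ d with hU
  set L : ℝ := Real.exp (-1 - 2 * d) / 2 ^ d with hL
  have hU0 : 0 < U := by positivity
  have hL0 : 0 < L := by positivity
  -- This K satisfies (L/U)K = e; as d ≥ 1, (L/U)(1+K)^d ≥ e and its logarithm is at least 1.
  refine ⟨Real.exp 1 * U / L, by positivity, fun N β h0 h1 hN => ?_⟩
  set K := Real.exp 1 * U / L with hK
  have hK0 : 0 < K := by positivity
  have hN1 : 1 ≤ N := Nat.one_le_iff_ne_zero.mpr fun h => by simp [h] at hN; linarith
  have h := log_div_le_mul_meanDisplacement (s := K * β) hN1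
    (A := L / β ^ d) (B := U / ((1 + K) * β) ^ d) (by positivity) (by positivity)
    (le_partitionFunction_of_one_le_mul h0 (by nlinarith) hN)
    (by
      have : β + K * β = (1 + K) * β := by ring
      rw [this]
      exact partitionFunction_le hd (by positivity) h1)
  have hAB : L / β ^ d / (U / ((1 + K) * β) ^ d) = L / U * (1 + K) ^ d := by
    rw [mul_pow]
    field_simp
  have hone : 1 ≤ Real.log (L / U * (1 + K) ^ d) := by
    rw [Real.le_log_iff_exp_le (by positivity)]
    have h2 : 1 + K ≤ (1 + K) ^ d := le_self_pow₀ (by linarith) (by omega)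
    calc
      Real.exp 1 = L / U * K := by rw [hK]; field_simp
      _ ≤ L / U * (1 + K) ^ d := by gcongr; linarith
  rw [hAB] at h
  rw [div_le_iff₀ h0]
  linarith

theorem exists_le_mul_meanDisplacement_of_mul_le {d : ℕ} (hd : 1 ≤ d) (c : ℝ) :
    ∃ K : ℝ, 0 < K ∧ ∀ (N : ℕ) (β : ℝ), 1 ≤ N → K ≤ N → 0 ≤ β → β * N ≤ c →
      (N : ℝ) ≤ K * meanDisplacement d N β := by
  set U : ℝ := (2 * (d + 1)) ^ d with hU
  set L : ℝ := Real.exp (-1 - 2 * d * c) with hL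
  have hU0 : 0 < U := by positivity
  have hL0 : 0 < L := by positivity
  -- Here (L/U)(K-1) = e, and the added 1 ensures K ≤ K^d.
  refine ⟨1 + Real.exp 1 * U / L, by positivity, fun N β hN1 hKN h0 hc => ?_⟩
  set K := 1 + Real.exp 1 * U / L with hK
  have hK1 : 1 ≤ K := le_add_of_nonneg_right (by positivity)
  have hN0 : (0 : ℝ) < N := by exact_mod_cast hN1
  have h := log_div_le_mul_meanDisplacement (β := β) (s := K / N) hN1
    (A := N ^ d * L) (B := U / (K / N) ^ d) (by positivity) (by positivity)
    (by
      refine le_trans ?_ (le_partitionFunction (d := d) hN1 le_rfl h0)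
      gcongr
      exact Real.exp_le_exp.mpr (by gcongr))
    -- Z is decreasing, so β may be dropped from β + K/N; the row bound is then needed only at K/N,
    -- which is positive even if β = 0 and at most 1 as K ≤ N.
    ((partitionFunction_add_le d N h0).trans <|
      partitionFunction_le hd (by positivity) (by rwa [div_le_one hN0]))
  have hAB : N ^ d * L / (U / (K / N) ^ d) = L / U * K ^ d := by
    rw [div_pow]
    field_simp
  have hone : 1 ≤ Real.log (L / U * K ^ d) := by
    rw [Real.le_log_iff_exp_le (by positivity)]
    have h2 : K ≤ K ^ d := le_self_pow₀ hK1 (by omega)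
    calc
      Real.exp 1 = L / U * (K - 1) := by rw [hK]; field_simp; ring
      _ ≤ L / U * K ^ d := by gcongr; linarith
  rw [hAB, div_mul_eq_mul_div K] at h
  have h3 := hone.trans h
  rwa [one_le_div hN0] at h3

end RandomEuclideanBijection

theorem theorem1p1 (d : ℕ) (hd : 1 ≤ d) (β : ℕ → ℝ) (hβ : ∀ N, 0 ≤ β N) :
    (((fun N : ℕ => 1 / (N : ℝ)) =o[atTop] β ∧ β =o[atTop] (fun _ : ℕ => (1 : ℝ))) →
      (fun N : ℕ => RandomEuclideanBijection.meanDisplacement d N (β N))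
        =Θ[atTop] (fun N : ℕ => 1 / β N)) ∧
    (β =O[atTop] (fun N : ℕ => 1 / (N : ℝ)) →
      (fun N : ℕ => RandomEuclideanBijection.meanDisplacement d N (β N))
        =Θ[atTop] (fun N : ℕ => (N : ℝ))) := by
  refine ⟨fun ⟨hlow, hhigh⟩ => ?_, fun hO => ?_⟩
  · have hN : ∀ᶠ N in atTop, 0 < β N ∧ 1 ≤ β N * N := by
      filter_upwards [hlow.bound one_pos, eventually_ge_atTop 1] with N h hN1
      have hN0 : (0 : ℝ) < N := by exact_mod_cast hN1
      rw [one_mul, Real.norm_of_nonneg (by positivity), Real.norm_of_nonneg (hβ N)] at h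
      exact ⟨lt_of_lt_of_le (by positivity) h, (div_le_iff₀ hN0).mp h⟩
    -- Arbitrary c is needed because the lower bound evaluates Z at (1+K)β, which must stay at most
    -- 1.
    have hsmall : ∀ c : ℝ, 0 < c → ∀ᶠ N in atTop, c * β N ≤ 1 := by
      intro c hc
      filter_upwards [hhigh.bound (inv_pos.mpr hc)] with N h
      rw [Real.norm_of_nonneg (hβ N), norm_one, mul_one] at h
      rwa [mul_comm, ← le_div_iff₀ hc, one_div]
    constructor
    · obtain ⟨C, hC⟩ := RandomEuclideanBijection.exists_meanDisplacement_le_div hd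
      refine Asymptotics.IsBigO.of_bound C ?_
      filter_upwards [hN, hsmall 1 one_pos] with N h1 h2
      rw [Real.norm_of_nonneg (RandomEuclideanBijection.meanDisplacement_nonneg _ _ _),
        Real.norm_of_nonneg (one_div_nonneg.mpr (hβ N))]
      exact hC N (β N) h1.1 (by linarith) h1.2
    · obtain ⟨K, hK0, hK⟩ := RandomEuclideanBijection.exists_inv_le_meanDisplacement hd
      refine Asymptotics.IsBigO.of_bound K ?_
      filter_upwards [hN, hsmall (1 + K) (by positivity)] with N h1 h2
      rw [Real.norm_of_nonneg (RandomEuclideanBijection.meanDisplacement_nonneg _ _ _),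
        Real.norm_of_nonneg (one_div_nonneg.mpr (hβ N))]
      exact hK N (β N) h1.1 h2 h1.2
  · constructor
    · refine Asymptotics.IsBigO.of_bound d (Eventually.of_forall fun N => ?_)
      rw [Real.norm_of_nonneg (RandomEuclideanBijection.meanDisplacement_nonneg _ _ _),
        Real.norm_of_nonneg (Nat.cast_nonneg N)]
      exact RandomEuclideanBijection.meanDisplacement_le (β N)
    · obtain ⟨c, hc⟩ := hO.bound
      obtain ⟨K, hK0, hK⟩ :=
        RandomEuclideanBijection.exists_le_mul_meanDisplacement_of_mul_le hd c
      refine Asymptotics.IsBigO.of_bound K ?_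
      filter_upwards [hc, eventually_ge_atTop 1, eventually_ge_atTop ⌈K⌉₊] with N h hN1 hKN
      have hN0 : (0 : ℝ) < N := by exact_mod_cast hN1
      rw [Real.norm_of_nonneg (hβ N), Real.norm_of_nonneg (by positivity), mul_one_div,
        le_div_iff₀ hN0] at h
      rw [Real.norm_of_nonneg (RandomEuclideanBijection.meanDisplacement_nonneg _ _ _),
        Real.norm_of_nonneg (Nat.cast_nonneg N)]
      exact hK N (β N) hN1 (Nat.ceil_le.mp hKN) (hβ N) h
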